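/- Let $\tau$ be the substitution $a\mapsto ab$, $b\mapsto ac$, $c\mapsto a$, and let $\mathbb{T}=x_1x_2x_3\cdots$ be the Tribonacci word, i.e. the infinite fixed point of $\tau$ that begins with $a$. Let $t_{-2}=0$, $t_{-1}=t_0=1$ and $t_m=t_{m-1}+t_{m-2}+t_{m-3}$ for $m\ge 1$. For $n\ge 0$ let $B(n)$ be the number of pairs $(\omega,p)$ such that $\omega$ is a nonempty palindrome occurring in $\mathbb{T}$, $p\ge 1$, and the $p$-th occurrence (from left to right) of $\omega$ in $\mathbb{T}$ lies inside the prefix $x_1x_2\cdots x_n$; that is, $B(n)$ counts the nonempty palindromes in this prefix with multiplicity. Then for every integer $m\ge 0$, $$B(t_m)=\frac{m}{22}\bigl(10t_{m}+5t_{m-1}+3t_{m-2}\bigr)+\frac{1}{22}\bigl(-23t_{m}+12t_{m-1}-5t_{m-2}\bigr)+m+\frac{3}{2}.$$ -/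

import Mathlib

/-- The alphabet `{a, b, c}`. -/
inductive TribLetter : Type
  | a : TribLetter
  | b : TribLetter
  | c : TribLetter
  deriving DecidableEq

/-- The Tribonacci substitution on letters: `a ↦ ab`, `b ↦ ac`, `c ↦ a`. -/
def tribSubst : TribLetter → List TribLetter
  | TribLetter.a => [TribLetter.a, TribLetter.b]
  | TribLetter.b => [TribLetter.a, TribLetter.c]
  | TribLetter.c => [TribLetter.a]

/-- The Tribonacci substitution extended to finite words by concatenation. -/
def tribMorphism (w : List TribLetter) : List TribLetter := w.flatMap tribSubst

/-- The finite word obtained by applying the substitution `m` times to the letter `a`. -/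
def tribFiniteWord (m : ℕ) : List TribLetter := tribMorphism^[m] [TribLetter.a]

theorem length_le_length_tribMorphism (w : List TribLetter) :
    w.length ≤ (tribMorphism w).length := by
  induction w with
  | nil => simp
  | cons x w ih =>
    have h : tribMorphism (x :: w) = tribSubst x ++ tribMorphism w := by
      simp [tribMorphism]
    rw [h]
    cases x <;> simp [tribSubst] <;> omega

theorem tribFiniteWord_eq_cons (m : ℕ) :
    ∃ w, tribFiniteWord m = TribLetter.a :: w ∧ m ≤ w.length := by
  induction m with
  | zero => exact ⟨[], rfl, le_refl _⟩
  | succ m ih =>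
    obtain ⟨w, hw, hm⟩ := ih
    refine ⟨TribLetter.b :: tribMorphism w, ?_, ?_⟩
    · unfold tribFiniteWord at hw ⊢
      rw [Function.iterate_succ_apply', hw]
      simp [tribMorphism, tribSubst]
    · have := length_le_length_tribMorphism w
      simp only [List.length_cons]
      omega

theorem lt_length_tribFiniteWord (m : ℕ) : m < (tribFiniteWord m).length := by
  obtain ⟨w, hw, hm⟩ := tribFiniteWord_eq_cons m
  rw [hw, List.length_cons]
  omega

/-- The infinite Tribonacci word, the fixed point of the substitution that begins with `a`
(the common extension of all the `tribFiniteWord m`, each of which is a prefix of the next).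
Letters are indexed from `0`: `tribWord i` is the letter `x_{i+1}` of `x₁x₂x₃⋯`. -/
def tribWord (i : ℕ) : TribLetter := (tribFiniteWord i)[i]'(lt_length_tribFiniteWord i)

/-- The word `w` occurs in the Tribonacci word with its first letter at (0-based) position `i`. -/
def TribOccursAt (w : List TribLetter) (i : ℕ) : Prop :=
  ∀ (j : ℕ) (hj : j < w.length), w[j] = tribWord (i + j)

/-- The nonempty palindromes that occur in the Tribonacci word. -/
def tribPalindromes : Set (List TribLetter) :=
  {w | w ≠ [] ∧ w.Palindrome ∧ ∃ i, TribOccursAt w i}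

/-- The `p`-th occurrence (`p = 1, 2, …`, from left to right) of `w` in the Tribonacci word is the
one that starts at (0-based) position `i`: the word occurs there, and exactly `p` of its
occurrences start at or before `i`. -/
def IsTribOccurrence (w : List TribLetter) (p i : ℕ) : Prop :=
  TribOccursAt w i ∧ {j : ℕ | j ≤ i ∧ TribOccursAt w j}.ncard = p

/-- `B(n)`: the number of pairs `(w, p)` such that `w` is a nonempty palindrome of the Tribonacci
word and its `p`-th occurrence lies in the prefix of length `n`. -/
noncomputable def tribPalindromeCount (n : ℕ) : ℕ :=
  {x : List TribLetter × ℕ | x.1 ∈ tribPalindromes ∧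
    ∃ i, IsTribOccurrence x.1 x.2 i ∧ i + x.1.length ≤ n}.ncard

/-- Tribonacci numbers indexed from `0`: `0, 1, 1, 2, 4, 7, 13, …`. -/
def tribNat : ℕ → ℕ
  | 0 => 0
  | 1 => 1
  | 2 => 1
  | n + 3 => tribNat (n + 2) + tribNat (n + 1) + tribNat n

/-- Tribonacci numbers `t_j` for `j ≥ -2`: `t_{-2} = 0`, `t_{-1} = t_0 = 1` and
`t_j = t_{j-1} + t_{j-2} + t_{j-3}` for `j ≥ 1`. (The value for `j < -2` is never used.) -/
def tribNumber (j : ℤ) : ℕ := tribNat (j + 2).toNat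

open TribLetter

/-! Let E(k) be the number of nonempty palindromes ending with the k-th letter. An occurrence is an
interval of positions, so B(n) = E(1) + ⋯ + E(n) (`tribPalindromeCount_eq_sum`).

Write σ for `tribBlockStart`. A palindromic factor with ends `a` is τ(v)a for a palindrome v, and
one with ends `b` or `c` is such a word stripped of its outer letters. Hence E(σ(j) + 1) = E(j) + 1,
and E(σ(j+1)) = E(j+1) when the letter at j is not `c`.

Split B according to the last letter of the palindrome. In the prefix of length σ(n), the `a`-part
is B(n) + n - E(n), while the `b`- and `c`-parts are the `a`- and `b`-parts of the prefix of length
n. Since σ(t_m) = t_{m+1}, three steps back give B(t_{m+3}) = Σ (B(t_i) + t_i - E(t_i)) over i = m,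
m+1, m+2. The values E(t_i) are explicit, with sum 2m + 3, and the closed form satisfies the
resulting recurrence and its three initial values. -/

/-! ### The substitution: injectivity and reversal -/

theorem tribMorphism_cons (x : TribLetter) (w : List TribLetter) :
    tribMorphism (x :: w) = tribSubst x ++ tribMorphism w := by
  simp [tribMorphism]

theorem tribMorphism_append (u v : List TribLetter) :
    tribMorphism (u ++ v) = tribMorphism u ++ tribMorphism v := by
  simp [tribMorphism]

theorem tribMorphism_ne_b_cons (u v : List TribLetter) : tribMorphism u ≠ b :: v := by
  rcases u with _ | ⟨x, u⟩
  · simp [tribMorphism]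
  · cases x <;> simp [tribMorphism_cons, tribSubst]

theorem tribMorphism_ne_c_cons (u v : List TribLetter) : tribMorphism u ≠ c :: v := by
  rcases u with _ | ⟨x, u⟩
  · simp [tribMorphism]
  · cases x <;> simp [tribMorphism_cons, tribSubst]

/-- Every nonempty image starts with `a`, so the letter after an initial `a` tells which block was
read: `b`, `c`, or neither. -/
theorem tribMorphism_injective : Function.Injective tribMorphism := by
  intro u
  induction u with
  | nil =>
    intro v h
    rcases v with _ | ⟨y, v⟩
    · rfl
    · rw [tribMorphism_cons] at h
      cases y <;> simp [tribSubst, tribMorphism] at h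
  | cons x u ih =>
    intro v h
    rcases v with _ | ⟨y, v⟩
    · rw [tribMorphism_cons] at h
      cases x <;> simp [tribSubst, tribMorphism] at h
    · rw [tribMorphism_cons, tribMorphism_cons] at h
      cases x <;> cases y <;> simp only [tribSubst, List.cons_append, List.nil_append,
        List.cons.injEq, true_and, reduceCtorEq, false_and] at h
      · rw [ih h]
      · exact absurd h.symm (tribMorphism_ne_b_cons _ _)
      · rw [ih h]
      · exact absurd h.symm (tribMorphism_ne_c_cons _ _)
      · exact absurd h (tribMorphism_ne_b_cons _ _)
      · exact absurd h (tribMorphism_ne_c_cons _ _)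
      · rw [ih h]

/-- Letter by letter, `a` followed by the reversed block equals the block followed by `a`; the extra
`a` travels through the word. -/
theorem reverse_tribMorphism (w : List TribLetter) :
    a :: (tribMorphism w).reverse = tribMorphism w.reverse ++ [a] := by
  induction w with
  | nil => rfl
  | cons x w ih =>
    rw [tribMorphism_cons, List.reverse_append, List.reverse_cons, tribMorphism_append,
      ← List.cons_append, ih]
    cases x <;> simp [tribMorphism, tribSubst]

theorem reverse_tribMorphism_append_eq_iff (w : List TribLetter) :
    (tribMorphism w ++ [a]).reverse = tribMorphism w ++ [a] ↔ w.reverse = w := by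
  rw [List.reverse_append, List.reverse_singleton, List.singleton_append, reverse_tribMorphism,
    List.append_left_inj, tribMorphism_injective.eq_iff]

/-! ### Factors and block structure of the Tribonacci word -/

theorem tribFiniteWord_succ (m : ℕ) : tribFiniteWord (m + 1) = tribMorphism (tribFiniteWord m) :=
  Function.iterate_succ_apply' _ _ _

theorem tribFiniteWord_prefix_succ (m : ℕ) : tribFiniteWord m <+: tribFiniteWord (m + 1) := by
  induction m with
  | zero => exact ⟨[b], rfl⟩
  | succ m ih =>
    obtain ⟨v, hv⟩ := ih
    refine ⟨tribMorphism v, ?_⟩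
    rw [tribFiniteWord_succ (m + 1), ← hv, tribMorphism_append, ← tribFiniteWord_succ, hv]

theorem tribFiniteWord_prefix {m n : ℕ} (h : m ≤ n) : tribFiniteWord m <+: tribFiniteWord n := by
  induction n, h using Nat.le_induction with
  | base => exact List.prefix_refl _
  | succ n _ ih => exact ih.trans (tribFiniteWord_prefix_succ n)

theorem tribFiniteWord_getElem (m i : ℕ) (h : i < (tribFiniteWord m).length) :
    (tribFiniteWord m)[i] = tribWord i := by
  unfold tribWord
  rcases le_total m i with hm | hm
  · exact (tribFiniteWord_prefix hm).getElem h
  · exact ((tribFiniteWord_prefix hm).getElem (lt_length_tribFiniteWord i)).symm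

/-- The factor of the Tribonacci word that occupies the positions `i, …, j - 1`. -/
def tribFactor (i j : ℕ) : List TribLetter := (List.range' i (j - i)).map tribWord

@[simp] theorem length_tribFactor (i j : ℕ) : (tribFactor i j).length = j - i := by
  simp [tribFactor]

theorem tribFactor_getElem (i j k : ℕ) (h : k < (tribFactor i j).length) :
    (tribFactor i j)[k] = tribWord (i + k) := by
  simp [tribFactor]

theorem tribFactor_append {i j k : ℕ} (hij : i ≤ j) (hjk : j ≤ k) :
    tribFactor i j ++ tribFactor j k = tribFactor i k := by
  unfold tribFactor
  rw [← List.map_append]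
  congr 1
  obtain ⟨d, rfl⟩ := Nat.exists_eq_add_of_le hij
  obtain ⟨e, rfl⟩ := Nat.exists_eq_add_of_le hjk
  rw [Nat.add_sub_cancel_left, Nat.add_sub_cancel_left, show i + d + e - i = d + e by omega,
    List.range'_append_1]

@[simp] theorem tribFactor_self (i : ℕ) : tribFactor i i = [] := by simp [tribFactor]

theorem tribFactor_succ (i : ℕ) : tribFactor i (i + 1) = [tribWord i] := by
  simp [tribFactor]

theorem eq_tribFactor_of_prefix_tribFiniteWord {m n : ℕ} {w : List TribLetter} (hw : w.length = n)
    (hp : w <+: tribFiniteWord m) : w = tribFactor 0 n := by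
  apply List.ext_getElem
  · simp [hw]
  · intro i h₁ h₂
    rw [tribFactor_getElem, Nat.zero_add, hp.getElem h₁, tribFiniteWord_getElem]

/-- The position in the Tribonacci word at which the image of its `n`-th letter starts. -/
def tribBlockStart (n : ℕ) : ℕ := (tribMorphism (tribFactor 0 n)).length

theorem tribMorphism_tribFactor_zero (n : ℕ) :
    tribMorphism (tribFactor 0 n) = tribFactor 0 (tribBlockStart n) := by
  have h : tribFactor 0 n = (tribFiniteWord n).take n :=
    (eq_tribFactor_of_prefix_tribFiniteWord
      (by rw [List.length_take]; exact min_eq_left (lt_length_tribFiniteWord n).le)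
      (List.take_prefix _ _)).symm
  refine eq_tribFactor_of_prefix_tribFiniteWord (m := n + 1) rfl ?_
  rw [tribFiniteWord_succ, h]
  refine ⟨tribMorphism ((tribFiniteWord n).drop n), ?_⟩
  rw [← tribMorphism_append, List.take_append_drop]

theorem tribBlockStart_succ (n : ℕ) :
    tribBlockStart (n + 1) = tribBlockStart n + (tribSubst (tribWord n)).length := by
  unfold tribBlockStart
  rw [← tribFactor_append (Nat.zero_le n) n.le_succ, tribMorphism_append, List.length_append,
    tribFactor_succ]
  simp [tribMorphism]

@[simp] theorem tribBlockStart_zero : tribBlockStart 0 = 0 := rfl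

theorem tribBlockStart_strictMono : StrictMono tribBlockStart := by
  refine strictMono_nat_of_lt_succ fun n => ?_
  rw [tribBlockStart_succ]
  cases tribWord n <;> simp [tribSubst]

theorem tribMorphism_tribFactor {i j : ℕ} (h : i ≤ j) :
    tribMorphism (tribFactor i j) = tribFactor (tribBlockStart i) (tribBlockStart j) := by
  have h₁ := tribMorphism_tribFactor_zero j
  rw [← tribFactor_append (Nat.zero_le i) h, tribMorphism_append, tribMorphism_tribFactor_zero i,
    ← tribFactor_append (Nat.zero_le _) (tribBlockStart_strictMono.monotone h)] at h₁
  exact List.append_cancel_left h₁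

theorem tribFactor_tribBlockStart_succ (n : ℕ) :
    tribFactor (tribBlockStart n) (tribBlockStart (n + 1)) = tribSubst (tribWord n) := by
  rw [← tribMorphism_tribFactor n.le_succ, tribFactor_succ]
  simp [tribMorphism]

theorem tribWord_tribBlockStart_add (n k : ℕ) (hk : k < (tribSubst (tribWord n)).length) :
    tribWord (tribBlockStart n + k) = (tribSubst (tribWord n))[k] := by
  have h := tribFactor_getElem (tribBlockStart n) (tribBlockStart (n + 1)) k
    (by rw [tribFactor_tribBlockStart_succ]; exact hk)
  rw [← h]
  simp only [tribFactor_tribBlockStart_succ]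

theorem tribWord_tribBlockStart (n : ℕ) : tribWord (tribBlockStart n) = a := by
  have h := tribWord_tribBlockStart_add n 0 (by cases tribWord n <;> simp [tribSubst])
  rw [Nat.add_zero] at h
  rw [h]
  cases tribWord n <;> rfl

theorem tribBlock_of_eq_a {n : ℕ} (h : tribWord n = a) :
    tribBlockStart (n + 1) = tribBlockStart n + 2 ∧ tribWord (tribBlockStart n + 1) = b := by
  refine ⟨by rw [tribBlockStart_succ, h]; rfl, ?_⟩
  rw [tribWord_tribBlockStart_add n 1 (by simp [h, tribSubst])]
  simp [h, tribSubst]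

theorem tribBlock_of_eq_b {n : ℕ} (h : tribWord n = b) :
    tribBlockStart (n + 1) = tribBlockStart n + 2 ∧ tribWord (tribBlockStart n + 1) = c := by
  refine ⟨by rw [tribBlockStart_succ, h]; rfl, ?_⟩
  rw [tribWord_tribBlockStart_add n 1 (by simp [h, tribSubst])]
  simp [h, tribSubst]

theorem tribBlock_of_eq_c {n : ℕ} (h : tribWord n = c) :
    tribBlockStart (n + 1) = tribBlockStart n + 1 := by
  rw [tribBlockStart_succ, h]; rfl

theorem tribBlock_of_ne_c {n : ℕ} (h : tribWord n ≠ c) :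
    tribBlockStart (n + 1) = tribBlockStart n + 2 ∧ tribWord (tribBlockStart n + 1) ≠ a := by
  rcases hn : tribWord n with _ | _ | _
  · simp [tribBlock_of_eq_a hn]
  · simp [tribBlock_of_eq_b hn]
  · exact absurd hn h

theorem exists_tribBlockStart (p : ℕ) : ∃ n, p = tribBlockStart n ∨
    (p = tribBlockStart n + 1 ∧ tribWord n ≠ c) := by
  induction p with
  | zero => exact ⟨0, Or.inl rfl⟩
  | succ p ih =>
    obtain ⟨n, rfl | ⟨rfl, hn⟩⟩ := ih
    · by_cases h : tribWord n = c
      · exact ⟨n + 1, Or.inl (tribBlock_of_eq_c h).symm⟩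
      · exact ⟨n, Or.inr ⟨rfl, h⟩⟩
    · exact ⟨n + 1, Or.inl (tribBlock_of_ne_c hn).1.symm⟩

theorem eq_tribBlockStart_of_eq_a {p : ℕ} (h : tribWord p = a) : ∃ n, p = tribBlockStart n := by
  obtain ⟨n, rfl | ⟨rfl, hn⟩⟩ := exists_tribBlockStart p
  · exact ⟨n, rfl⟩
  · exact absurd h (tribBlock_of_ne_c hn).2

theorem eq_tribBlockStart_succ_of_ne_a {p : ℕ} (h : tribWord p ≠ a) :
    ∃ n, p = tribBlockStart n + 1 ∧ tribWord n ≠ c := by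
  obtain ⟨n, rfl | hn⟩ := exists_tribBlockStart p
  · exact absurd (tribWord_tribBlockStart n) h
  · exact ⟨n, hn⟩

/-! ### Palindromes and desubstitution -/

/-- The factor at the positions `i, …, j - 1` is a palindrome. -/
abbrev TribPal (i j : ℕ) : Prop := (tribFactor i j).reverse = tribFactor i j

theorem TribPal.tribWord_eq {i j : ℕ} (h : TribPal i (j + 1)) (hij : i ≤ j) :
    tribWord i = tribWord j := by
  have h₁ : 0 < (tribFactor i (j + 1)).length := by rw [length_tribFactor]; omega
  have h₂ : (tribFactor i (j + 1))[0] = (tribFactor i (j + 1)).reverse[0]'(by simpa using h₁) := by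
    simp only [show (tribFactor i (j + 1)).reverse = tribFactor i (j + 1) from h]
  rw [List.getElem_reverse, tribFactor_getElem, tribFactor_getElem, length_tribFactor] at h₂
  rw [show i + (j + 1 - i - 1 - 0) = j by omega] at h₂
  exact h₂

theorem tribPal_tribBlockStart {i j : ℕ} (h : i ≤ j) :
    TribPal (tribBlockStart i) (tribBlockStart j + 1) ↔ TribPal i j := by
  unfold TribPal
  rw [← tribFactor_append (tribBlockStart_strictMono.monotone h) (Nat.le_succ _), tribFactor_succ,
    tribWord_tribBlockStart, ← tribMorphism_tribFactor h, reverse_tribMorphism_append_eq_iff]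

theorem tribPal_inner {i j : ℕ} (hij : i < j) (h : tribWord i = tribWord j) :
    TribPal i (j + 1) ↔ TribPal (i + 1) j := by
  unfold TribPal
  rw [← tribFactor_append hij.le j.le_succ, ← tribFactor_append i.le_succ hij, tribFactor_succ,
    tribFactor_succ, h]
  simp

theorem tribPal_tribBlockStart_succ {i j : ℕ} (h : i < j) :
    TribPal (tribBlockStart i + 1) (tribBlockStart j) ↔ TribPal i j := by
  rw [← tribPal_inner (tribBlockStart_strictMono h), tribPal_tribBlockStart h.le]
  rw [tribWord_tribBlockStart, tribWord_tribBlockStart]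

/-- The number of nonempty palindromes of the Tribonacci word whose last letter is at `k - 1`. -/
def tribPalEnding (k : ℕ) : ℕ := ((Finset.range k).filter fun i => TribPal i k).card

theorem tribPalEnding_tribBlockStart_add_one (j : ℕ) :
    tribPalEnding (tribBlockStart j + 1) = tribPalEnding j + 1 := by
  -- The extra start i = j is the empty palindrome, which corresponds to the single letter `a`.
  have h₁ : ((Finset.range (j + 1)).filter fun i => TribPal i j).card = tribPalEnding j + 1 := by
    rw [Finset.range_add_one, Finset.filter_insert, if_pos (by simp [TribPal]),
      Finset.card_insert_of_notMem (by simp)]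
    rfl
  rw [← h₁, ← Finset.card_image_of_injective _ tribBlockStart_strictMono.injective]
  unfold tribPalEnding
  congr 1
  ext p
  simp only [Finset.mem_filter, Finset.mem_range, Finset.mem_image]
  constructor
  · rintro ⟨hp, hpal⟩
    obtain ⟨i, rfl⟩ := eq_tribBlockStart_of_eq_a
      ((hpal.tribWord_eq (Nat.lt_succ_iff.1 hp)).trans (tribWord_tribBlockStart j))
    have hij : i ≤ j := tribBlockStart_strictMono.le_iff_le.1 (Nat.lt_succ_iff.1 hp)
    exact ⟨i, ⟨Nat.lt_succ_of_le hij, (tribPal_tribBlockStart hij).1 hpal⟩, rfl⟩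
  · rintro ⟨i, ⟨hi, hpal⟩, rfl⟩
    have hij := Nat.lt_succ_iff.1 hi
    exact ⟨Nat.lt_succ_of_le (tribBlockStart_strictMono.monotone hij),
      (tribPal_tribBlockStart hij).2 hpal⟩

theorem tribPalEnding_tribBlockStart_succ {j : ℕ} (hj : tribWord j ≠ c) :
    tribPalEnding (tribBlockStart (j + 1)) = tribPalEnding (j + 1) := by
  have hinj : Function.Injective fun i => tribBlockStart i + 1 := fun i j h =>
    tribBlockStart_strictMono.injective (Nat.succ_injective h)
  unfold tribPalEnding
  rw [← Finset.card_image_of_injective ((Finset.range (j + 1)).filter _) hinj]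
  congr 1
  ext p
  simp only [Finset.mem_filter, Finset.mem_range, Finset.mem_image]
  obtain ⟨hs, hne⟩ := tribBlock_of_ne_c hj
  constructor
  · rintro ⟨hp, hpal⟩
    have hw : tribWord p = tribWord (tribBlockStart j + 1) := by
      rw [hs] at hp hpal
      exact hpal.tribWord_eq (Nat.lt_succ_iff.1 hp)
    obtain ⟨i, rfl, -⟩ := eq_tribBlockStart_succ_of_ne_a (hw ▸ hne)
    have hij : i < j + 1 := tribBlockStart_strictMono.lt_iff_lt.1 (by omega)
    exact ⟨i, ⟨hij, (tribPal_tribBlockStart_succ hij).1 hpal⟩, rfl⟩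
  · rintro ⟨i, ⟨hij, hpal⟩, rfl⟩
    refine ⟨?_, (tribPal_tribBlockStart_succ hij).2 hpal⟩
    -- The two ends of the palindrome carry the same letter, so block i also has length 2 and its
    -- second position exists.
    have hw : tribWord i ≠ c := by rw [hpal.tribWord_eq (Nat.lt_succ_iff.1 hij)]; exact hj
    have := (tribBlock_of_ne_c hw).1
    have := tribBlockStart_strictMono.monotone (show i + 1 ≤ j + 1 from hij)
    omega

/-! ### Sums by letter and Tribonacci lengths -/

/-- The sum of `f` over the positions below `n` that carry the letter `x`. -/
def tribLetterSum (f : ℕ → ℕ) (x : TribLetter) (n : ℕ) : ℕ :=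
  ∑ k ∈ Finset.range n, if tribWord k = x then f k else 0

theorem tribLetterSum_succ (f : ℕ → ℕ) (x : TribLetter) (n : ℕ) :
    tribLetterSum f x (n + 1) = tribLetterSum f x n + if tribWord n = x then f n else 0 :=
  Finset.sum_range_succ _ _

theorem sum_tribLetterSum (f : ℕ → ℕ) (n : ℕ) :
    tribLetterSum f a n + tribLetterSum f b n + tribLetterSum f c n
      = ∑ k ∈ Finset.range n, f k := by
  unfold tribLetterSum
  rw [← Finset.sum_add_distrib, ← Finset.sum_add_distrib]
  refine Finset.sum_congr rfl fun k _ => ?_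
  cases tribWord k <;> simp

/-- Each block contributes one `a`, at its start; a `b` comes only from the block of an `a`, and a
`c` only from the block of a `b`. -/
theorem tribLetterSum_tribBlockStart (f g h : ℕ → ℕ) (hg : ∀ n, f (tribBlockStart n) = g n)
    (hh : ∀ n, tribWord n ≠ c → f (tribBlockStart n + 1) = h n) (n : ℕ) :
    tribLetterSum f a (tribBlockStart n) = ∑ k ∈ Finset.range n, g k ∧
    tribLetterSum f b (tribBlockStart n) = tribLetterSum h a n ∧
    tribLetterSum f c (tribBlockStart n) = tribLetterSum h b n := by
  induction n with
  | zero => simp [tribLetterSum]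
  | succ n ih =>
    have h₀ := tribWord_tribBlockStart n
    obtain ⟨h₁, h₂, h₃⟩ := ih
    rw [Finset.sum_range_succ, tribLetterSum_succ h, tribLetterSum_succ h]
    rcases hn : tribWord n with _ | _ | _
    · obtain ⟨hs, hw⟩ := tribBlock_of_eq_a hn
      simp [hs, tribLetterSum_succ, h₀, hw, h₁, h₂, h₃, hg, hh n (by simp [hn])]
    · obtain ⟨hs, hw⟩ := tribBlock_of_eq_b hn
      simp [hs, tribLetterSum_succ, h₀, hw, h₁, h₂, h₃, hg, hh n (by simp [hn])]
    · have hs := tribBlock_of_eq_c hn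
      simp [hs, tribLetterSum_succ, h₀, h₁, h₂, h₃, hg]

theorem tribBlockStart_eq_add (n : ℕ) : tribBlockStart n =
    n + tribLetterSum (fun _ => 1) a n + tribLetterSum (fun _ => 1) b n := by
  obtain ⟨h₁, h₂, h₃⟩ := tribLetterSum_tribBlockStart (fun _ => 1) (fun _ => 1) (fun _ => 1)
    (fun _ => rfl) (fun _ _ => rfl) n
  have h := sum_tribLetterSum (fun _ => 1) (tribBlockStart n)
  simp only [Finset.sum_const, Finset.card_range, smul_eq_mul, mul_one] at h h₁
  omega

/-- The letter counts evolve by the incidence matrix of τ, whose characteristic equation is x³ = x²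
+ x + 1. -/
theorem tribBlockStart_iterate_three (n : ℕ) :
    tribBlockStart (tribBlockStart (tribBlockStart n)) =
      tribBlockStart (tribBlockStart n) + tribBlockStart n + n := by
  have h (n : ℕ) := tribLetterSum_tribBlockStart (fun _ => 1) (fun _ => 1) (fun _ => 1)
    (fun _ => rfl) (fun _ _ => rfl) n
  simp only [Finset.sum_const, Finset.card_range, smul_eq_mul, mul_one] at h
  have h₁ := h n
  have h₂ := h (tribBlockStart n)
  have h₃ := tribBlockStart_eq_add (tribBlockStart (tribBlockStart n))
  omega

theorem tribWord_zero : tribWord 0 = a := rfl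

theorem tribBlockStart_tribNat (m : ℕ) : tribBlockStart (tribNat (m + 2)) = tribNat (m + 3) := by
  have h₁ : tribBlockStart 1 = 2 := (tribBlock_of_eq_a tribWord_zero).1
  have h₂ : tribBlockStart 2 = 4 := by
    have h := tribBlock_of_eq_b (n := 1) (tribBlock_of_eq_a tribWord_zero).2
    rw [h.1, h₁]
  induction m using Nat.strong_induction_on with
  | _ m ih =>
    match m with
    | 0 => exact h₁
    | 1 => exact h₂
    | m + 2 =>
      have e₁ := ih m (by omega)
      have e₂ := ih (m + 1) (by omega)
      have h := tribBlockStart_iterate_three (tribNat (m + 2))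
      rw [e₁, e₂] at h
      rw [h]
      rfl

theorem tribNumber_natCast (m : ℕ) : tribNumber m = tribNat (m + 2) := by
  unfold tribNumber
  congr 1

theorem tribNumber_succ (m : ℕ) :
    tribNumber ((m + 1 : ℕ) : ℤ) = tribBlockStart (tribNumber m) := by
  rw [tribNumber_natCast, tribNumber_natCast, tribBlockStart_tribNat]

/-! ### Palindromes ending at the Tribonacci positions -/

theorem tribWord_pred_of_eq_c {n : ℕ} (h : tribWord n = c) :
    ∃ k, n = k + 1 ∧ tribWord k = a := by
  obtain ⟨k, rfl, -⟩ := eq_tribBlockStart_succ_of_ne_a (p := n) (by simp [h])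
  exact ⟨_, rfl, tribWord_tribBlockStart k⟩

theorem tribPalEnding_zero : tribPalEnding 0 = 0 := rfl

theorem tribPalEnding_one : tribPalEnding 1 = 1 :=
  tribPalEnding_tribBlockStart_add_one 0

theorem tribPalEnding_step_a {n u v : ℕ} (hx : tribWord n = a) (hu : tribPalEnding (n + 1) = u)
    (hv : tribPalEnding n = v) : ∃ n', tribBlockStart (n + 1) = n' + 1 ∧ tribWord n' = b ∧
      tribPalEnding (n' + 1) = u ∧ tribPalEnding n' = v + 1 := by
  obtain ⟨hs, hw⟩ := tribBlock_of_eq_a hx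
  refine ⟨_, hs, hw, ?_, ?_⟩
  · rw [← hs, tribPalEnding_tribBlockStart_succ (by simp [hx]), hu]
  · rw [tribPalEnding_tribBlockStart_add_one, hv]

theorem tribPalEnding_step_b {n u v : ℕ} (hx : tribWord n = b) (hu : tribPalEnding (n + 1) = u)
    (hv : tribPalEnding n = v) : ∃ n', tribBlockStart (n + 1) = n' + 1 ∧ tribWord n' = c ∧
      tribPalEnding (n' + 1) = u ∧ tribPalEnding n' = v + 1 := by
  obtain ⟨hs, hw⟩ := tribBlock_of_eq_b hx
  refine ⟨_, hs, hw, ?_, ?_⟩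
  · rw [← hs, tribPalEnding_tribBlockStart_succ (by simp [hx]), hu]
  · rw [tribPalEnding_tribBlockStart_add_one, hv]

theorem tribPalEnding_step_c {n v : ℕ} (hx : tribWord n = c)
    (hv : tribPalEnding n = v) : ∃ n', tribBlockStart (n + 1) = n' + 1 ∧ tribWord n' = a ∧
      tribPalEnding (n' + 1) = v + 1 ∧ tribPalEnding n' = v := by
  refine ⟨_, tribBlock_of_eq_c hx, tribWord_tribBlockStart n, ?_, ?_⟩
  · rw [tribPalEnding_tribBlockStart_add_one, hv]
  · obtain ⟨k, rfl, hk⟩ := tribWord_pred_of_eq_c hx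
    rw [tribPalEnding_tribBlockStart_succ (by simp [hk]), hv]

/-- The last letter of the prefix cycles through `a`, `b`, `c`. The count just before it must be
carried along, since the step from `c` to `a` uses that count instead of the one at the end; a full
cycle adds 2 to both. -/
theorem tribPalEnding_tribNumber_aux (k : ℕ) : ∃ n, tribNumber ((3 * k : ℕ) : ℤ) = n + 1 ∧
    tribWord n = a ∧ tribPalEnding (n + 1) = 2 * k + 1 ∧ tribPalEnding n = 2 * k := by
  induction k with
  | zero => exact ⟨0, rfl, rfl, tribPalEnding_one, tribPalEnding_zero⟩
  | succ k ih =>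
    obtain ⟨n, hn, hx, hu, hv⟩ := ih
    obtain ⟨n₁, hn₁, hx₁, hu₁, hv₁⟩ := tribPalEnding_step_a hx hu hv
    obtain ⟨n₂, hn₂, hx₂, hu₂, hv₂⟩ := tribPalEnding_step_b hx₁ hu₁ hv₁
    obtain ⟨n₃, hn₃, hx₃, hu₃, hv₃⟩ := tribPalEnding_step_c hx₂ hv₂
    refine ⟨n₃, ?_, hx₃, hu₃, hv₃⟩
    rw [show 3 * (k + 1) = 3 * k + 1 + 1 + 1 by ring, tribNumber_succ, tribNumber_succ,
      tribNumber_succ, hn, hn₁, hn₂, hn₃]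

theorem tribPalEnding_tribNumber (k : ℕ) :
    tribPalEnding (tribNumber ((3 * k : ℕ) : ℤ)) = 2 * k + 1 ∧
    tribPalEnding (tribNumber ((3 * k + 1 : ℕ) : ℤ)) = 2 * k + 1 ∧
    tribPalEnding (tribNumber ((3 * k + 2 : ℕ) : ℤ)) = 2 * k + 1 := by
  obtain ⟨n, hn, hx, hu, hv⟩ := tribPalEnding_tribNumber_aux k
  obtain ⟨n₁, hn₁, hx₁, hu₁, hv₁⟩ := tribPalEnding_step_a hx hu hv
  obtain ⟨n₂, hn₂, hx₂, hu₂, hv₂⟩ := tribPalEnding_step_b hx₁ hu₁ hv₁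
  rw [tribNumber_succ (3 * k + 1), tribNumber_succ (3 * k), hn, hn₁, hn₂]
  exact ⟨hu, hu₁, hu₂⟩

theorem sum_tribPalEnding_tribNumber (m : ℕ) :
    tribPalEnding (tribNumber (m : ℤ)) + tribPalEnding (tribNumber ((m + 1 : ℕ) : ℤ))
      + tribPalEnding (tribNumber ((m + 2 : ℕ) : ℤ)) = 2 * m + 3 := by
  obtain ⟨k, rfl | rfl | rfl⟩ : ∃ k, m = 3 * k ∨ m = 3 * k + 1 ∨ m = 3 * k + 2 :=
    ⟨m / 3, by omega⟩
  all_goals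
    have h₁ := tribPalEnding_tribNumber k
    have h₂ := tribPalEnding_tribNumber (k + 1)
    simp only [Nat.mul_add, Nat.mul_one, Nat.add_assoc, Nat.reduceAdd] at h₁ h₂ ⊢
    omega

/-! ### Occurrences as intervals -/

theorem tribFactor_occursAt (i j : ℕ) : TribOccursAt (tribFactor i j) i :=
  fun k hk => tribFactor_getElem i j k hk

theorem TribOccursAt.eq_tribFactor {w : List TribLetter} {i : ℕ} (h : TribOccursAt w i) :
    w = tribFactor i (i + w.length) := by
  apply List.ext_getElem
  · simp
  · intro k h₁ h₂
    rw [h k h₁, tribFactor_getElem]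

theorem finite_occursAt_le (w : List TribLetter) (i : ℕ) :
    {j : ℕ | j ≤ i ∧ TribOccursAt w j}.Finite :=
  (Set.finite_Iic i).subset fun _ h => h.1

theorem ncard_occursAt_strictMono {w : List TribLetter} {i j : ℕ} (hij : i < j)
    (hj : TribOccursAt w j) :
    {k : ℕ | k ≤ i ∧ TribOccursAt w k}.ncard < {k : ℕ | k ≤ j ∧ TribOccursAt w k}.ncard := by
  refine Set.ncard_lt_ncard ⟨fun k hk => ⟨hk.1.trans hij.le, hk.2⟩, fun h => ?_⟩
    (finite_occursAt_le w j)
  exact absurd (h ⟨le_rfl, hj⟩).1 (by omega)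

theorem tribPalindromeCount_eq_sum (n : ℕ) :
    tribPalindromeCount n = ∑ k ∈ Finset.range n, tribPalEnding (k + 1) := by
  let s : Finset (Σ _ : ℕ, ℕ) := (Finset.range n).sigma fun k =>
    (Finset.range (k + 1)).filter fun i => TribPal i (k + 1)
  let f : (Σ _ : ℕ, ℕ) → List TribLetter × ℕ := fun x =>
    (tribFactor x.2 (x.1 + 1),
      {j : ℕ | j ≤ x.2 ∧ TribOccursAt (tribFactor x.2 (x.1 + 1)) j}.ncard)
  have hs : s.card = ∑ k ∈ Finset.range n, tribPalEnding (k + 1) := Finset.card_sigma _ _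
  have hmem (k i : ℕ) : (⟨k, i⟩ : Σ _ : ℕ, ℕ) ∈ s ↔ k < n ∧ i ≤ k ∧ TribPal i (k + 1) := by
    simp only [s, Finset.mem_sigma, Finset.mem_filter, Finset.mem_range, Nat.lt_succ_iff]
  -- The rank of an occurrence strictly increases with its start, so word and rank determine the
  -- start, and the length then gives the end.
  have hf : Set.InjOn f s := by
    rintro ⟨k, i⟩ hx ⟨k', i'⟩ hx' h
    rw [Finset.mem_coe, hmem] at hx hx'
    obtain ⟨hw, hp⟩ := Prod.mk.inj h
    simp only at hw hp
    rw [← hw] at hp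
    have hi : i = i' := by
      rcases lt_trichotomy i i' with hlt | heq | hlt
      · exact absurd hp (ncard_occursAt_strictMono hlt
          (hw ▸ tribFactor_occursAt i' (k' + 1))).ne
      · exact heq
      · exact absurd hp (ncard_occursAt_strictMono hlt (tribFactor_occursAt i (k + 1))).ne'
    have hl := congrArg List.length hw
    rw [length_tribFactor, length_tribFactor] at hl
    obtain rfl := hi
    obtain rfl : k = k' := by omega
    rfl
  rw [← hs, ← Set.ncard_coe_finset, ← hf.ncard_image]
  unfold tribPalindromeCount
  congr 1
  ext ⟨w, p⟩
  simp only [Set.mem_ofPred_eq, Set.mem_image, Finset.mem_coe]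
  constructor
  · rintro ⟨⟨hne, hpal, -⟩, i, ⟨hocc, hcard⟩, hle⟩
    have hpos := List.length_pos_iff.2 hne
    have hw := hocc.eq_tribFactor
    rw [show i + w.length = i + w.length - 1 + 1 by omega] at hw
    refine ⟨⟨i + w.length - 1, i⟩, (hmem _ _).2 ⟨by omega, by omega, ?_⟩, ?_⟩
    · unfold TribPal
      rw [← hw]
      exact hpal.reverse_eq
    · simp only [f]
      rw [← hw, hcard]
  · rintro ⟨⟨k, i⟩, hx, h⟩
    obtain ⟨hk, hik, hpal⟩ := (hmem _ _).1 hx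
    obtain ⟨rfl, rfl⟩ := Prod.mk.inj h
    refine ⟨⟨?_, List.Palindrome.of_reverse_eq hpal, i, tribFactor_occursAt _ _⟩, i,
      ⟨tribFactor_occursAt _ _, rfl⟩, ?_⟩
    · rw [← List.length_pos_iff]
      simp only [length_tribFactor]
      omega
    · simp only [length_tribFactor]
      omega

/-! ### The recurrence and its solution -/

theorem tribLetterSum_tribPalEnding_tribBlockStart (n : ℕ) :
    tribLetterSum (fun k => tribPalEnding (k + 1)) a (tribBlockStart n) + tribPalEnding n
      = tribPalindromeCount n + n ∧
    tribLetterSum (fun k => tribPalEnding (k + 1)) b (tribBlockStart n)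
      = tribLetterSum (fun k => tribPalEnding (k + 1)) a n ∧
    tribLetterSum (fun k => tribPalEnding (k + 1)) c (tribBlockStart n)
      = tribLetterSum (fun k => tribPalEnding (k + 1)) b n := by
  obtain ⟨h₁, h₂, h₃⟩ := tribLetterSum_tribBlockStart (fun k => tribPalEnding (k + 1))
    (fun k => tribPalEnding k + 1) (fun k => tribPalEnding (k + 1))
    tribPalEnding_tribBlockStart_add_one
    (fun k hk => by rw [← tribPalEnding_tribBlockStart_succ hk, (tribBlock_of_ne_c hk).1]) n
  refine ⟨?_, h₂, h₃⟩
  -- The `a`-part sums E(0), …, E(n-1), whereas B(n) sums E(1), …, E(n); as E(0) = 0, they differ by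
  -- E(n).
  have h := Finset.sum_range_succ' tribPalEnding n
  rw [Finset.sum_range_succ, tribPalEnding_zero] at h
  rw [h₁, tribPalindromeCount_eq_sum, Finset.sum_add_distrib, Finset.sum_const, Finset.card_range,
    smul_eq_mul, mul_one]
  omega

theorem tribPalindromeCount_tribNumber_succ (m : ℕ) :
    tribPalindromeCount (tribNumber ((m + 3 : ℕ) : ℤ)) + (2 * m + 3) =
      tribPalindromeCount (tribNumber ((m + 2 : ℕ) : ℤ))
      + tribPalindromeCount (tribNumber ((m + 1 : ℕ) : ℤ))
      + tribPalindromeCount (tribNumber (m : ℤ))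
      + tribNumber ((m + 3 : ℕ) : ℤ) := by
  have hE := sum_tribPalEnding_tribNumber m
  have ht : tribNumber ((m + 3 : ℕ) : ℤ) = tribNumber ((m + 2 : ℕ) : ℤ)
      + tribNumber ((m + 1 : ℕ) : ℤ) + tribNumber (m : ℤ) := by
    simp only [tribNumber_natCast]
    rfl
  have h₀ := tribLetterSum_tribPalEnding_tribBlockStart (tribNumber m)
  have h₁ := tribLetterSum_tribPalEnding_tribBlockStart (tribNumber (m + 1 : ℕ))
  have h₂ := tribLetterSum_tribPalEnding_tribBlockStart (tribNumber (m + 2 : ℕ))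
  rw [← tribNumber_succ] at h₀ h₁ h₂
  have hs := sum_tribLetterSum (fun k => tribPalEnding (k + 1)) (tribNumber (m + 3 : ℕ))
  rw [← tribPalindromeCount_eq_sum] at hs
  simp only [Nat.add_assoc, Nat.reduceAdd] at *
  omega

theorem tribPalindromeCount_one : tribPalindromeCount 1 = 1 := by
  rw [tribPalindromeCount_eq_sum, Finset.sum_range_one, tribPalEnding_one]

theorem tribPalindromeCount_two : tribPalindromeCount 2 = 2 := by
  rw [tribPalindromeCount_eq_sum]
  rfl

theorem tribPalindromeCount_four : tribPalindromeCount 4 = 5 := by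
  rw [tribPalindromeCount_eq_sum]
  rfl

theorem mainTheorem2 (m : ℕ) :
    (tribPalindromeCount (tribNumber m) : ℚ) =
      (m : ℚ) / 22 * (10 * (tribNumber m : ℚ) + 5 * (tribNumber ((m : ℤ) - 1) : ℚ)
          + 3 * (tribNumber ((m : ℤ) - 2) : ℚ))
        + 1 / 22 * (-23 * (tribNumber m : ℚ) + 12 * (tribNumber ((m : ℤ) - 1) : ℚ)
          - 5 * (tribNumber ((m : ℤ) - 2) : ℚ))
        + m + 3 / 2 := by
  have e₁ (m : ℕ) : tribNumber ((m : ℤ) - 1) = tribNat (m + 1) := by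
    unfold tribNumber; congr 1; omega
  have e₂ (m : ℕ) : tribNumber ((m : ℤ) - 2) = tribNat m := by
    unfold tribNumber; congr 1; omega
  induction m using Nat.strong_induction_on with
  | _ m ih =>
    match m with
    | 0 =>
      rw [e₁, e₂, tribNumber_natCast]
      norm_num [tribNat, tribPalindromeCount_one]
    | 1 =>
      rw [e₁, e₂, tribNumber_natCast]
      norm_num [tribNat, tribPalindromeCount_two]
    | 2 =>
      rw [e₁, e₂, tribNumber_natCast]
      norm_num [tribNat, tribPalindromeCount_four]
    | m + 3 =>
      have i₀ := ih m (by omega)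
      have i₁ := ih (m + 1) (by omega)
      have i₂ := ih (m + 2) (by omega)
      have h := congrArg (Nat.cast (R := ℚ)) (tribPalindromeCount_tribNumber_succ m)
      simp only [e₁, e₂, tribNumber_natCast, tribNat] at i₀ i₁ i₂ h ⊢
      push_cast at i₀ i₁ i₂ h ⊢
      -- Once the Tribonacci numbers are unfolded to three consecutive ones, the closed form
      -- satisfies the same recurrence identically.
      linear_combination h + i₀ + i₁ + i₂
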